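/- Let $d\ge 1$, let $R\subset\mathbb R^d$ be open with Lipschitz boundary and outward unit normal $\mathbf n$, and put $D=R\times S^{d-1}$, $\partial D=\partial R\times S^{d-1}$, $\partial D_-=\{(\mathbf r,\mathbf s)\in\partial D:\ \mathbf n(\mathbf r)\cdot\mathbf s<0\}$. Let $(\cdot,\cdot)$ be the inner product of $V_0=L^2(D)$, and write $(\cdot,\cdot)_{\partial D}$, $(\cdot,\cdot)_{\partial D_-}$ for integration over $\partial D$, $\partial D_-$ with respect to the surface measure. Let $V_1$ be the space of $v\in V_0$ with $\mathbf s\cdot\nabla_{\mathbf r}v\in V_0$ and trace in $L^2(\partial D;|\mathbf s\cdot\mathbf n|)$, i.e. the completion of the functions smooth on $\overline D$ and of finite norm in the norm $(\|v\|^2+\|\mathbf s\cdot\nabla_{\mathbf r} v\|^2+\||\mathbf s\cdot\mathbf n|^{1/2}v\|_{L^2(\partial D)}^2)^{1/2}$. With $v^\pm(\mathbf r,\mathbf s)=\frac12(v(\mathbf r,\mathbf s)\pm v(\mathbf r,-\mathbf s))$ and $V^\pm=\{v^\pm: v\in V\}$, let $W=V_1^+\oplus V_0^-$. Let $\sigma_s,\sigma_t\in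 L^\infty(R)$ be positive a.e. with $\sigma_t-\sigma_s\ge c_0$ a.e. in $R$ for some constant $c_0>0$, and set $\rho=\|\sigma_s/\sigma_t\|_{L^\infty(R)}$. Let $\theta:[-1,1]\to\mathbb R$ be measurable and non-negative with $\int_{S^{d-1}}\theta(\mathbf s\cdot\mathbf s')\,d\mathbf s'=1$ for a.e. $\mathbf s\in S^{d-1}$, and let $(\Theta v)(\mathbf r,\mathbf s)=\int_{S^{d-1}}\theta(\mathbf s\cdot\mathbf s')v(\mathbf r,\mathbf s')\,d\mathbf s'$. Let $q\in L^2(D)$ and $q_\partial\in L^2(\partial D_-;|\mathbf s\cdot\mathbf n|)$. For $u,v\in W$ define $$t(u,v)=(\mathbf s\cdot\nabla u^+,v^-)-(u^-,\mathbf s\cdot\nabla v^+)+(\sigma_t u,v)+(|\mathbf s\cdot\mathbf n|\,u^+,v^+)_{\partial D},$$ $$s(u,v)=(\sigma_s\Theta u,v),\qquad \ell(v)=(q,v)-2(\mathbf s\cdot\mathbf n\,q_\partial,v^+)_{\partial D_-},\qquad \|v\|_{\sigma_t}=\|\sqrt{\sigma_t}\,v\|_{L^2(D)}.$$ Then for every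 $w\in W$ there is exactly one $r\in W$ such that $$t(r,v)=\ell(v)-\bigl(t(w,v)-s(w,v)\bigr)\qquad\text{for all } v\in W;$$ denote it by $\mathcal R(w)$ (the preconditioned residual of $w$). If $u_k,u_{k+1/2}\in W$ are related by the source-iteration half-step $$t(u_{k+1/2},v)=s(u_k,v)+\ell(v)\qquad\text{for all } v\in W,$$ then $$\|\mathcal R(u_{k+1/2})\|_{\sigma_t}\le\rho\,\|\mathcal R(u_k)\|_{\sigma_t}.$$ Moreover $\mathcal R(u_k)=u_{k+1/2}-u_k$, and $t(\mathcal R(u_{k+1/2}),v)=s(\mathcal R(u_k),v)$ for all $v\in W$. -/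

import Mathlib

open MeasureTheory Topology
open scoped ContDiff

noncomputable section

namespace RTE

/-- The Euclidean space `ℝ^d`. -/
abbrev E (d : ℕ) := EuclideanSpace ℝ (Fin d)

/-- The unit sphere `S^{d-1}` of directions. -/
abbrev Sph (d : ℕ) := Metric.sphere (0 : EuclideanSpace ℝ (Fin d)) 1

/-- The surface measure on `S^{d-1}`. -/
def sphMeas (d : ℕ) : Measure (Sph d) := (volume : Measure (E d)).toSphere

/-- `(r, s) ↦ (r, -s)`. -/
def flip {d : ℕ} (z : E d × Sph d) : E d × Sph d := (z.1, -z.2)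

/-! ### The spatial domain -/

/-- `R` has a Lipschitz boundary: near every boundary point there are a unit vector `ν` and a
Lipschitz function `γ` (evaluated only on the hyperplane orthogonal to `ν`) such that `R` is the
region strictly above the graph of `γ` in direction `ν`. -/
def HasLipschitzBoundary {d : ℕ} (R : Set (E d)) : Prop :=
  ∀ x ∈ frontier R, ∃ ν : E d, ‖ν‖ = 1 ∧ ∃ (K : NNReal) (γ : E d → ℝ), LipschitzWith K γ ∧
    ∃ ε > 0, ∀ y ∈ Metric.ball x ε, (y ∈ R ↔ γ (y - inner ℝ ν y • ν) < inner ℝ ν y)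

/-- `n` is the outward unit normal of `R` at `x`: every cone around `-n` with opening less than a
half space is near `x` contained in `R`, and every such cone around `n` is near `x` disjoint
from `R`. Where the boundary is a Lipschitz graph this says that the graph is differentiable at
`x` with normal `n`; so there is exactly one such `n` at almost every boundary point. -/
def IsOutwardNormal {d : ℕ} (R : Set (E d)) (x n : E d) : Prop :=
  ‖n‖ = 1 ∧ ∀ ε > 0, ∀ᶠ y in 𝓝 x,
    (inner ℝ (y - x) n < -(ε * ‖y - x‖) → y ∈ R) ∧
    (ε * ‖y - x‖ < inner ℝ (y - x) n → y ∉ R)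

open Classical in
/-- The outward unit normal field of `R` (zero where there is none). -/
def normal {d : ℕ} (R : Set (E d)) (x : E d) : E d :=
  if h : ∃ n, IsOutwardNormal R x n then h.choose else 0

/-! ### Measures and function spaces on `D = R × S^{d-1}` and on `∂D = ∂R × S^{d-1}` -/

/-- The product measure `dr ds` on `D = R × S^{d-1}`. -/
def phaseMeas {d : ℕ} (R : Set (E d)) : Measure (E d × Sph d) :=
  ((volume : Measure (E d)).restrict R).prod (sphMeas d)

/-- The measure `|s · n(r)| dS(r) ds` on `∂D = ∂R × S^{d-1}`, where `dS` is the surface measure. -/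
def bdryMeas {d : ℕ} (R : Set (E d)) : Measure (E d × Sph d) :=
  (((Measure.euclideanHausdorffMeasure (d - 1) : Measure (E d)).restrict (frontier R)).prod
    (sphMeas d)).withDensity
      fun z => ENNReal.ofReal |inner ℝ (z.2 : E d) (normal R z.1)|

/-- The inflow boundary `∂D₋`. -/
def inflow {d : ℕ} (R : Set (E d)) : Set (E d × Sph d) :=
  {z | z.1 ∈ frontier R ∧ inner ℝ (normal R z.1) (z.2 : E d) < 0}

/-- The measure `|s · n(r)| dS(r) ds` on the inflow boundary `∂D₋`. -/
def inflowMeas {d : ℕ} (R : Set (E d)) : Measure (E d × Sph d) :=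
  (bdryMeas R).restrict (inflow R)

/-- `V₀ = L²(D)`. -/
abbrev V0 {d : ℕ} (R : Set (E d)) := Lp ℝ 2 (phaseMeas R)

/-- `L²(∂D; |s · n|)`. -/
abbrev LB {d : ℕ} (R : Set (E d)) := Lp ℝ 2 (bdryMeas R)

/-- The graph `φ ↦ (φ, s · ∇φ, φ|_{∂D})` over the functions `φ` that are smooth up to the
boundary (restrictions to `D` of smooth functions of `(r, s)`) and for which the three components
are square integrable; this is no restriction when `R` is bounded. The gradient is taken with
respect to `r` only. -/
def smoothGraph {d : ℕ} (R : Set (E d)) : Submodule ℝ (V0 R × V0 R × LB R) where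
  carrier := {x | ∃ φ : E d × E d → ℝ, ContDiff ℝ ∞ φ ∧
    (x.1 =ᵐ[phaseMeas R] fun z => φ (z.1, (z.2 : E d))) ∧
    (x.2.1 =ᵐ[phaseMeas R] fun z => fderiv ℝ φ (z.1, (z.2 : E d)) ((z.2 : E d), 0)) ∧
    (x.2.2 =ᵐ[bdryMeas R] fun z => φ (z.1, (z.2 : E d)))}
  zero_mem' := by
    refine ⟨fun _ => 0, contDiff_const, Lp.coeFn_zero _ _ _, ?_, Lp.coeFn_zero _ _ _⟩
    filter_upwards [Lp.coeFn_zero ℝ 2 (phaseMeas R)] with z hz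
    simpa using hz
  add_mem' := by
    rintro x y ⟨φ, hφ, h1, h2, h3⟩ ⟨ψ, hψ, k1, k2, k3⟩
    refine ⟨fun p => φ p + ψ p, hφ.add hψ, ?_, ?_, ?_⟩
    · filter_upwards [h1, k1, Lp.coeFn_add x.1 y.1] with z a b c
      rw [Prod.fst_add, c, Pi.add_apply, a, b]
    · filter_upwards [h2, k2, Lp.coeFn_add x.2.1 y.2.1] with z a b c
      rw [Prod.snd_add, Prod.fst_add, c, Pi.add_apply, a, b,
        fderiv_fun_add (hφ.differentiable (by simp) _) (hψ.differentiable (by simp) _)]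
      rfl
    · filter_upwards [h3, k3, Lp.coeFn_add x.2.2 y.2.2] with z a b c
      rw [Prod.snd_add, Prod.snd_add, c, Pi.add_apply, a, b]
  smul_mem' := by
    rintro c x ⟨φ, hφ, h1, h2, h3⟩
    refine ⟨fun p => c • φ p, hφ.const_smul c, ?_, ?_, ?_⟩
    · filter_upwards [h1, Lp.coeFn_smul c x.1] with z a b
      rw [Prod.smul_fst, b, Pi.smul_apply, a]
    · filter_upwards [h2, Lp.coeFn_smul c x.2.1] with z a b
      rw [Prod.smul_snd, Prod.smul_fst, b, Pi.smul_apply, a,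
        fderiv_fun_const_smul (hφ.differentiable (by simp) _)]
      rfl
    · filter_upwards [h3, Lp.coeFn_smul c x.2.2] with z a b
      rw [Prod.smul_snd, Prod.smul_snd, b, Pi.smul_apply, a]

/-- `V₁`, the completion of the smooth functions in the graph norm of `v`, `s · ∇v` and the trace
of `v`, realised as the closure of the graph: an element is a triple `(v, s · ∇v, v|_{∂D})`.
(By the integration by parts formula `(s · n v, v)_{∂D} = 2 (s · ∇v, v)` the norm with the trace
on `∂D` is equivalent to the norm with the trace on the inflow part `∂D₋` only.) -/
def V1 {d : ℕ} (R : Set (E d)) : Submodule ℝ (V0 R × V0 R × LB R) :=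
  (smoothGraph R).topologicalClosure

/-- The functions `f` (classes modulo `μ`) with `f(r, -s) = c f(r, s)`: the even ones for `c = 1`,
the odd ones for `c = -1`. -/
def parity {d : ℕ} (μ : Measure (E d × Sph d)) (c : ℝ) : Submodule ℝ (Lp ℝ 2 μ) where
  carrier := {f | ∃ g : E d × Sph d → ℝ, (∀ z, g (flip z) = c * g z) ∧ f =ᵐ[μ] g}
  zero_mem' := ⟨fun _ => 0, by simp, Lp.coeFn_zero _ _ _⟩
  add_mem' := by
    rintro x y ⟨f, hf, h⟩ ⟨g, hg, k⟩
    refine ⟨fun z => f z + g z, fun z => by simp only [hf, hg]; ring, ?_⟩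
    filter_upwards [h, k, Lp.coeFn_add x y] with z a b c
    rw [c, Pi.add_apply, a, b]
  smul_mem' := by
    rintro t x ⟨f, hf, h⟩
    refine ⟨fun z => t * f z, fun z => by simp only [hf]; ring, ?_⟩
    filter_upwards [h, Lp.coeFn_smul t x] with z a b
    rw [b, Pi.smul_apply, a, smul_eq_mul]

/-- `V₁⁺`, the even elements of `V₁`: the triple of an even `v` consists of the even `v`, the odd
`s · ∇v` and the even trace of `v`. -/
def V1even {d : ℕ} (R : Set (E d)) : Submodule ℝ (V0 R × V0 R × LB R) :=
  V1 R ⊓ (parity (phaseMeas R) 1).prod ((parity (phaseMeas R) (-1)).prod (parity (bdryMeas R) 1))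

/-- `V₀⁻`, the odd elements of `V₀`. -/
def V0odd {d : ℕ} (R : Set (E d)) : Submodule ℝ (V0 R) := parity (phaseMeas R) (-1)

/-- The space of mixed regularity `W = V₁⁺ ⊕ V₀⁻`. -/
abbrev W {d : ℕ} (R : Set (E d)) := V1even R × V0odd R

section

variable {d : ℕ} {R : Set (E d)}

/-- The even part `u⁺` of `u ∈ W`. -/
def W.even (u : W R) : V0 R := u.1.1.1

/-- `s · ∇u⁺` for `u ∈ W`. -/
def W.gradEven (u : W R) : V0 R := u.1.1.2.1

/-- The trace of `u⁺` on `∂D` for `u ∈ W`. -/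
def W.traceEven (u : W R) : LB R := u.1.1.2.2

/-- The odd part `u⁻` of `u ∈ W`. -/
def W.odd (u : W R) : V0 R := u.2.1

/-- The function `u = u⁺ + u⁻` in `L²(D)`. -/
def W.fn (u : W R) : V0 R := W.even u + W.odd u

end

/-! ### The variational formulation -/

/-- The scattering operator `(Θ v)(r, s) = ∫ θ(s · s') v(r, s') ds'`. -/
def Theta {d : ℕ} (θ : ℝ → ℝ) (v : E d × Sph d → ℝ) (z : E d × Sph d) : ℝ :=
  ∫ s', θ (inner ℝ (z.2 : E d) (s' : E d)) * v (z.1, s') ∂(sphMeas d)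

/-- `t(u, v) = (s·∇u⁺, v⁻) - (u⁻, s·∇v⁺) + (σ_t u, v) + (|s·n| u⁺, v⁺)_{∂D}`. -/
def tForm {d : ℕ} {R : Set (E d)} (σt : E d → ℝ) (u v : W R) : ℝ :=
  (∫ z, W.gradEven u z * W.odd v z ∂(phaseMeas R))
    - (∫ z, W.odd u z * W.gradEven v z ∂(phaseMeas R))
    + (∫ z, σt z.1 * W.fn u z * W.fn v z ∂(phaseMeas R))
    + (∫ z, W.traceEven u z * W.traceEven v z ∂(bdryMeas R))

/-- `s(u, v) = (σ_s Θ u, v)`. -/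
def sForm {d : ℕ} {R : Set (E d)} (σs : E d → ℝ) (θ : ℝ → ℝ) (u v : W R) : ℝ :=
  ∫ z, σs z.1 * Theta θ (W.fn u) z * W.fn v z ∂(phaseMeas R)

/-- `ℓ(v) = (q, v) - 2 (s·n q_∂, v⁺)_{∂D₋}`; here `s·n = -|s·n|` on `∂D₋`. -/
def load {d : ℕ} {R : Set (E d)} (q qb : E d × Sph d → ℝ) (v : W R) : ℝ :=
  (∫ z, q z * W.fn v z ∂(phaseMeas R))
    + 2 * ∫ z, qb z * W.traceEven v z ∂(inflowMeas R)

/-- `⟨R̃(w), v⟩ = ℓ(v) - (t(w, v) - s(w, v))`. -/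
def residual {d : ℕ} {R : Set (E d)} (σs σt : E d → ℝ) (θ : ℝ → ℝ) (q qb : E d × Sph d → ℝ)
    (w v : W R) : ℝ :=
  load q qb v - (tForm σt w v - sForm σs θ w v)

/-- `r` solves the transport problem without scattering whose load is the residual of `w`. -/
def IsPrecResidual {d : ℕ} {R : Set (E d)} (σs σt : E d → ℝ) (θ : ℝ → ℝ)
    (q qb : E d × Sph d → ℝ) (w r : W R) : Prop :=
  ∀ v : W R, tForm σt r v = residual σs σt θ q qb w v

open Classical in
/-- The preconditioned residual operator `w ↦ r` (zero where there is no solution `r`). -/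
def precResidual {d : ℕ} {R : Set (E d)} (σs σt : E d → ℝ) (θ : ℝ → ℝ)
    (q qb : E d × Sph d → ℝ) (w : W R) : W R :=
  if h : ∃ r : W R, IsPrecResidual σs σt θ q qb w r then h.choose else 0

/-- The weighted norm `‖√σ_t v‖_{L²(D)}`. -/
def weightedNorm {d : ℕ} {R : Set (E d)} (σt : E d → ℝ) (u : W R) : ℝ :=
  (eLpNorm (fun z => √(σt z.1) * W.fn u z) 2 (phaseMeas R)).toReal

/-- `ρ = ‖σ_s / σ_t‖_∞`. -/
def rho {d : ℕ} (R : Set (E d)) (σs σt : E d → ℝ) : ℝ :=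
  (eLpNorm (fun r => σs r / σt r) ⊤ (volume.restrict R)).toReal

end RTE

end

/-!
The form `t` is not coercive on `W`: its skew-symmetric part couples `s · ∇u⁺` with `u⁻`, and
`t(u, u)` does not control `s · ∇u⁺`. Even and odd functions are orthogonal with respect to weights
depending on `r` only, since the sphere measure is invariant under `s ↦ -s`. So the equation
`t(u, v) = F(v)`, tested with odd `v`, determines `u⁻ = σ_t⁻¹ (F⁻ - s · ∇u⁺)`, and what remains
is the problem for the form
`(σ_t⁻¹ s · ∇u⁺, s · ∇v⁺) + (σ_t u⁺, v⁺) + (|s · n| u⁺, v⁺)_{∂D}`, coercive on `V₁⁺` because `σ_t`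
is bounded and bounded away from zero. The Lax–Milgram theorem then gives existence and
uniqueness (`existsUnique_mixed`). It applies since `V₁⁺` is a closed subspace of a product of
three Hilbert spaces; parity is a closed condition by almost everywhere convergence of a
subsequence (`isClosed_parity`). No trace theorem or integration by parts is needed, as the elements
of `V₁` are triples `(v, s · ∇v, v|_{∂D})`.

The scattering operator `Θ` is a contraction of `L²(D)` by the Schur test
(`lintegral_kernel_sq_le`): its kernel is symmetric with row integrals one. It acts on `s` only,
and so commutes with multiplication by `√σ_t`. Hence `s(u, v) ≤ ρ ‖u‖_{σ_t} ‖v‖_{σ_t}`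
(`sForm_le_rho_mul`), while `‖u‖²_{σ_t} ≤ t(u, u)`. By uniqueness and linearity a half-step
satisfies `𝓡(u_k) = u_{k+1/2} - u_k` and `t(𝓡(u_{k+1/2}), v) = s(𝓡(u_k), v)`; testing the
latter with `v = 𝓡(u_{k+1/2})` gives the contraction.
-/

namespace RTE

/-! ### A mixed variational problem in Hilbert spaces -/

section Mixed

variable {H K V : Type*} [NormedAddCommGroup H] [InnerProductSpace ℝ H] [CompleteSpace H]
  [NormedAddCommGroup K] [InnerProductSpace ℝ K] [CompleteSpace K]
  [NormedAddCommGroup V] [InnerProductSpace ℝ V] [CompleteSpace V]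

/-- The Lax–Milgram theorem for operators instead of bilinear forms. -/
theorem exists_equiv_of_coercive (T : V →L[ℝ] V) {c : ℝ} (hc : 0 < c)
    (hT : ∀ v, c * ‖v‖ ^ 2 ≤ inner ℝ (T v) v) : ∃ S : V ≃L[ℝ] V, ∀ v, S v = T v := by
  have hco : IsCoercive ((innerSL ℝ).comp T : V →L[ℝ] V →L[ℝ] ℝ) :=
    ⟨c, hc, fun v => by simpa [pow_two, mul_assoc] using hT v⟩
  refine ⟨hco.continuousLinearEquivOfBilin, fun v => ext_inner_right ℝ fun w => ?_⟩
  rw [hco.continuousLinearEquivOfBilin_apply]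
  simp

omit [CompleteSpace V] in
/-- The inverse of a bounded coercive operator is coercive. -/
theorem coercive_symm (S : V ≃L[ℝ] V) {c : ℝ} (hc : 0 < c)
    (hS : ∀ v, c * ‖v‖ ^ 2 ≤ inner ℝ (S v) v) :
    ∃ c' > 0, ∀ v, c' * ‖v‖ ^ 2 ≤ inner ℝ (S.symm v) v := by
  have hN : 0 < ‖(S : V →L[ℝ] V)‖ + 1 := by positivity
  refine ⟨c / (‖(S : V →L[ℝ] V)‖ + 1) ^ 2, by positivity, fun v => ?_⟩
  have h1 : ‖v‖ ≤ (‖(S : V →L[ℝ] V)‖ + 1) * ‖S.symm v‖ := by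
    have := (S : V →L[ℝ] V).le_opNorm (S.symm v)
    simp only [ContinuousLinearEquiv.coe_coe, ContinuousLinearEquiv.apply_symm_apply] at this
    nlinarith [norm_nonneg (S.symm v)]
  have h2 : ‖v‖ ^ 2 ≤ (‖(S : V →L[ℝ] V)‖ + 1) ^ 2 * ‖S.symm v‖ ^ 2 := by
    rw [← mul_pow]
    exact pow_le_pow_left₀ (norm_nonneg _) h1 2
  have h3 := hS (S.symm v)
  rw [ContinuousLinearEquiv.apply_symm_apply, real_inner_comm] at h3
  refine le_trans ?_ h3
  rw [div_mul_eq_mul_div, div_le_iff₀ (by positivity)]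
  nlinarith

/-- Well-posedness of the mixed problem for unknowns `u.1 ∈ V` (the even part, with `g` for
`s · ∇` and `tr` for the trace) and `u.2 ∈ O` (the odd part). The equation tested with `O` gives
`u.2 = P⁻¹ (f₂ - g u.1)`, where `P` is the compression of `A` to `O`; inserting this into the
equation tested with `V` leaves a problem that is coercive on `V`. -/
theorem existsUnique_mixed (O : Submodule ℝ H) [CompleteSpace O]
    (e : V →L[ℝ] H) (g : V →L[ℝ] O) (tr : V →L[ℝ] K) (A : H →L[ℝ] H)
    {c : ℝ} (hc : 0 < c) (hA : ∀ x, c * ‖x‖ ^ 2 ≤ inner ℝ (A x) x)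
    (heo : ∀ (v : V) (o : O), inner ℝ (A (e v)) (o : H) = 0)
    (hoe : ∀ (v : V) (o : O), inner ℝ (A o) (e v) = 0)
    (hV : ∀ v, ‖v‖ ^ 2 ≤ ‖e v‖ ^ 2 + ‖g v‖ ^ 2 + ‖tr v‖ ^ 2)
    (f₁ : V) (f₂ : O) :
    ∃! u : V × O, ∀ v : V × O,
      inner ℝ (g u.1) v.2 - inner ℝ u.2 (g v.1)
        + inner ℝ (A (e u.1 + u.2)) (e v.1 + v.2) + inner ℝ (tr u.1) (tr v.1)
      = inner ℝ f₁ v.1 + inner ℝ f₂ v.2 := by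
  let P : O →L[ℝ] O := (ContinuousLinearMap.adjoint O.subtypeL) ∘L A ∘L O.subtypeL
  have hPi : ∀ x y : O, inner ℝ (P x) y = inner ℝ (A x) (y : H) := fun x y => by
    simp only [P, ContinuousLinearMap.comp_apply, ContinuousLinearMap.adjoint_inner_left]
    rfl
  have hP : ∀ o, c * ‖o‖ ^ 2 ≤ inner ℝ (P o) o := fun o => by
    rw [hPi]; exact hA o
  obtain ⟨S, hS⟩ := exists_equiv_of_coercive P hc hP
  obtain ⟨c', hc', hB⟩ := coercive_symm S hc (fun v => by rw [hS]; exact hP v)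
  let T : V →L[ℝ] V := (ContinuousLinearMap.adjoint e) ∘L A ∘L e
    + (ContinuousLinearMap.adjoint g) ∘L (S.symm : O →L[ℝ] O) ∘L g
    + (ContinuousLinearMap.adjoint tr) ∘L tr
  have hTi : ∀ x y : V, inner ℝ (T x) y = inner ℝ (A (e x)) (e y)
      + inner ℝ (S.symm (g x)) (g y) + inner ℝ (tr x) (tr y) := fun x y => by
    simp only [T, ContinuousLinearMap.comp_apply, add_apply, inner_add_left,
      ContinuousLinearMap.adjoint_inner_left, ContinuousLinearEquiv.coe_coe]
  have hT : ∀ v, min (min c c') 1 * ‖v‖ ^ 2 ≤ inner ℝ (T v) v := fun v => by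
    rw [hTi, real_inner_self_eq_norm_sq]
    have hm : 0 < min (min c c') 1 := by positivity
    have h1 := hA (e v)
    have h2 := hB (g v)
    have l1 : min (min c c') 1 * ‖e v‖ ^ 2 ≤ c * ‖e v‖ ^ 2 := by
      gcongr; exact (min_le_left _ _).trans (min_le_left _ _)
    have l2 : min (min c c') 1 * ‖g v‖ ^ 2 ≤ c' * ‖g v‖ ^ 2 := by
      gcongr; exact (min_le_left _ _).trans (min_le_right _ _)
    have l3 : min (min c c') 1 * ‖tr v‖ ^ 2 ≤ 1 * ‖tr v‖ ^ 2 := by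
      gcongr; exact min_le_right _ _
    have := mul_le_mul_of_nonneg_left (hV v) hm.le
    linarith
  obtain ⟨Q, hQ⟩ := exists_equiv_of_coercive T (by positivity) hT
  have hAeo : ∀ (u v : V × O), inner ℝ (A (e u.1 + u.2)) (e v.1 + v.2)
      = inner ℝ (A (e u.1)) (e v.1) + inner ℝ (S u.2) v.2 := fun u v => by
    rw [map_add, inner_add_left, inner_add_right, inner_add_right, heo, hoe, hS, hPi]
    ring
  let x : V := Q.symm (f₁ + ContinuousLinearMap.adjoint g (S.symm f₂))
  refine ⟨(x, S.symm (f₂ - g x)), fun v => ?_, fun u hu => ?_⟩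
  · have hx : inner ℝ (T x) v.1 = inner ℝ f₁ v.1 + inner ℝ (S.symm f₂) (g v.1) := by
      rw [← hQ, ContinuousLinearEquiv.apply_symm_apply, inner_add_left,
        ContinuousLinearMap.adjoint_inner_left]
    rw [hTi] at hx
    rw [hAeo]
    simp only [ContinuousLinearEquiv.apply_symm_apply, map_sub, inner_sub_left]
    linarith
  · have h2 : S u.2 = f₂ - g u.1 := ext_inner_right ℝ fun o => by
      have := hu (0, o)
      rw [hAeo] at this
      simp only [map_zero, inner_zero_right] at this
      rw [inner_sub_left]
      linarith
    have h2' : u.2 = S.symm (f₂ - g u.1) := by rw [← h2, S.symm_apply_apply]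
    have h1 : Q u.1 = f₁ + ContinuousLinearMap.adjoint g (S.symm f₂) := ext_inner_right ℝ fun y => by
      have := hu (y, 0)
      rw [hAeo, h2'] at this
      simp only [inner_zero_right, map_sub, inner_sub_left] at this
      rw [hQ, hTi, inner_add_left, ContinuousLinearMap.adjoint_inner_left]
      linarith
    have h1' : u.1 = x := by
      simp only [x, ← h1, Q.symm_apply_apply]
    exact Prod.ext h1' (by rw [h2', h1'])

/-- The mixed problem when the space of the even unknown is a closed space `Y` of triples
`(v, s · ∇v, v|_{∂D})`; here `Φ` is a parametrisation of the space of triples by a Hilbert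
space `Z`. -/
theorem existsUnique_mixed_of_param {Z : Type*} [NormedAddCommGroup Z] [InnerProductSpace ℝ Z]
    [CompleteSpace Z] (Φ : Z →L[ℝ] H × H × K) (hΦs : Function.Surjective Φ)
    (hΦ : ∀ z, ‖z‖ ^ 2 = ‖(Φ z).1‖ ^ 2 + ‖(Φ z).2.1‖ ^ 2 + ‖(Φ z).2.2‖ ^ 2)
    (O : Submodule ℝ H) (hO : IsClosed (O : Set H))
    (Y : Submodule ℝ (H × H × K)) (hY : IsClosed (Y : Set (H × H × K)))
    (hYO : ∀ y ∈ Y, y.2.1 ∈ O) (A : H →L[ℝ] H)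
    {c : ℝ} (hc : 0 < c) (hA : ∀ x, c * ‖x‖ ^ 2 ≤ inner ℝ (A x) x)
    (heo : ∀ y ∈ Y, ∀ o ∈ O, inner ℝ (A y.1) o = 0)
    (hoe : ∀ y ∈ Y, ∀ o ∈ O, inner ℝ (A o) y.1 = 0)
    (a b b' : H) (k : K) :
    ∃! u : Y × O, ∀ v : Y × O,
      inner ℝ u.1.1.2.1 (v.2 : H) - inner ℝ (u.2 : H) v.1.1.2.1
        + inner ℝ (A (u.1.1.1 + u.2)) (v.1.1.1 + v.2) + inner ℝ u.1.1.2.2 v.1.1.2.2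
      = inner ℝ a v.1.1.1 + inner ℝ b v.1.1.2.1 + inner ℝ k v.1.1.2.2
        + inner ℝ b' (v.2 : H) := by
  have : CompleteSpace O := hO.completeSpace_coe
  let V := Y.comap (Φ : Z →ₗ[ℝ] H × H × K)
  have : CompleteSpace V := (hY.preimage Φ.continuous).completeSpace_coe
  let Ψ : V →L[ℝ] H × H × K := Φ ∘L V.subtypeL
  have hΨ : ∀ v : V, Ψ v ∈ Y := fun v => v.2
  have hsurj : ∀ y ∈ Y, ∃ v : V, Ψ v = y := fun y hy => by
    obtain ⟨z, rfl⟩ := hΦs y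
    exact ⟨⟨z, hy⟩, rfl⟩
  let e : V →L[ℝ] H := ContinuousLinearMap.fst ℝ H (H × K) ∘L Ψ
  let g' : V →L[ℝ] H := ContinuousLinearMap.fst ℝ H K ∘L ContinuousLinearMap.snd ℝ H (H × K) ∘L Ψ
  let g : V →L[ℝ] O := g'.codRestrict O fun v => hYO _ (hΨ v)
  let tr : V →L[ℝ] K := ContinuousLinearMap.snd ℝ H K ∘L ContinuousLinearMap.snd ℝ H (H × K) ∘L Ψ
  obtain ⟨u, hu, huniq⟩ := existsUnique_mixed O e g tr A hc hA
    (fun v o => heo _ (hΨ v) _ o.2) (fun v o => hoe _ (hΨ v) _ o.2)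
    (fun v => (hΦ v).le)
    (ContinuousLinearMap.adjoint e a + ContinuousLinearMap.adjoint g' b
      + ContinuousLinearMap.adjoint tr k) (ContinuousLinearMap.adjoint O.subtypeL b')
  have hf : ∀ v : V × O, inner ℝ (ContinuousLinearMap.adjoint e a
      + ContinuousLinearMap.adjoint g' b + ContinuousLinearMap.adjoint tr k) v.1
      + inner ℝ (ContinuousLinearMap.adjoint O.subtypeL b') v.2
      = inner ℝ a (Ψ v.1).1 + inner ℝ b (Ψ v.1).2.1 + inner ℝ k (Ψ v.1).2.2
        + inner ℝ b' (v.2 : H) := fun v => by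
    rw [inner_add_left, inner_add_left, ContinuousLinearMap.adjoint_inner_left,
      ContinuousLinearMap.adjoint_inner_left, ContinuousLinearMap.adjoint_inner_left,
      ContinuousLinearMap.adjoint_inner_left]
    rfl
  refine ⟨(⟨Ψ u.1, hΨ _⟩, u.2), fun v => ?_, fun w hw => ?_⟩
  · obtain ⟨v', hv'⟩ := hsurj v.1.1 v.1.2
    have := (hu (v', v.2)).trans (hf _)
    rw [← hv']
    exact this
  · obtain ⟨w', hw'⟩ := hsurj w.1.1 w.1.2
    have := huniq (w', w.2) fun v => by
      have := hw (⟨Ψ v.1, hΨ _⟩, v.2)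
      rw [← hw'] at this
      exact this.trans (hf v).symm
    rw [← this]
    exact Prod.ext (Subtype.ext hw'.symm) rfl

omit [CompleteSpace H] [CompleteSpace K] in
/-- A product of three Hilbert spaces is, up to an equivalent norm, a Hilbert space. -/
theorem exists_hilbert_param : ∃ Φ : WithLp 2 (H × WithLp 2 (H × K)) →L[ℝ] H × H × K,
    Function.Surjective Φ ∧
      ∀ z, ‖z‖ ^ 2 = ‖(Φ z).1‖ ^ 2 + ‖(Φ z).2.1‖ ^ 2 + ‖(Φ z).2.2‖ ^ 2 := by
  let E₁ := WithLp.prodContinuousLinearEquiv 2 ℝ H K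
  let E₂ := WithLp.prodContinuousLinearEquiv 2 ℝ H (WithLp 2 (H × K))
  refine ⟨(E₂.trans ((ContinuousLinearEquiv.refl ℝ H).prodCongr E₁)).toContinuousLinearMap,
    (E₂.trans ((ContinuousLinearEquiv.refl ℝ H).prodCongr E₁)).surjective, fun z => ?_⟩
  rw [WithLp.prod_norm_sq_eq_of_L2, WithLp.prod_norm_sq_eq_of_L2, ← add_assoc]
  rfl

end Mixed

/-! ### Parity -/

/-- Almost everywhere limits inherit the parity: the pointwise limit of representatives with
`g (r, -s) = c g (r, s)`, put to zero where there is no limit, again has this property. -/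
theorem isClosed_parity {d : ℕ} (μ : Measure (E d × Sph d)) {c : ℝ} (hc : c ≠ 0) :
    IsClosed (parity μ c : Set (Lp ℝ 2 μ)) := by
  classical
  rw [← isSeqClosed_iff_isClosed]
  intro f f₀ hf hlim
  choose g hg hfg using hf
  obtain ⟨n, -, hn⟩ := (tendstoInMeasure_of_tendsto_Lp hlim).exists_seq_tendsto_ae
  have hflip : ∀ z : E d × Sph d, flip (flip z) = z := fun z => by simp [flip]
  let G : E d × Sph d → ℝ := fun z =>
    if h : ∃ l, Filter.Tendsto (fun i => g (n i) z) Filter.atTop (𝓝 l) then h.choose else 0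
  have hG : ∀ z l, Filter.Tendsto (fun i => g (n i) z) Filter.atTop (𝓝 l) → G z = l := by
    intro z l hl
    have h : ∃ l, Filter.Tendsto (fun i => g (n i) z) Filter.atTop (𝓝 l) := ⟨l, hl⟩
    simp only [G, dif_pos h]
    exact tendsto_nhds_unique h.choose_spec hl
  refine ⟨G, fun z => ?_, ?_⟩
  · by_cases h : ∃ l, Filter.Tendsto (fun i => g (n i) z) Filter.atTop (𝓝 l)
    · obtain ⟨l, hl⟩ := h
      rw [hG z l hl]
      refine hG _ _ ?_
      simp only [hg]
      exact hl.const_mul c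
    · have h' : ¬ ∃ l, Filter.Tendsto (fun i => g (n i) (flip z)) Filter.atTop (𝓝 l) := by
        rintro ⟨l, hl⟩
        refine h ⟨c⁻¹ * l, ?_⟩
        simp only [hg] at hl
        simpa [hc] using hl.const_mul c⁻¹
      simp [G, dif_neg h, dif_neg h']
  · filter_upwards [hn, ae_all_iff.mpr hfg] with z hz hz'
    refine (hG z _ ?_).symm
    simpa only [hz'] using hz

open scoped Pointwise in
theorem measurePreserving_neg_sphMeas (d : ℕ) :
    MeasurePreserving (fun s : Sph d => -s) (sphMeas d) (sphMeas d) := by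
  have hm : Measurable fun s : Sph d => -s := continuous_neg.measurable
  refine ⟨hm, Measure.ext fun A hA => ?_⟩
  rw [Measure.map_apply hm hA, sphMeas, Measure.toSphere_apply' _ (hm hA),
    Measure.toSphere_apply' _ hA]
  congr 1
  have h : (Subtype.val '' ((fun s : Sph d => -s) ⁻¹' A) : Set (E d)) = -(Subtype.val '' A) := by
    ext x
    constructor
    · rintro ⟨s, hs, rfl⟩
      exact ⟨-s, hs, by simp⟩
    · rintro ⟨s, hs, hx⟩
      exact ⟨-s, by simpa using hs, by simp [hx]⟩
  have h' : (Set.Ioo (0 : ℝ) 1 • -(Subtype.val '' A) : Set (E d))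
      = -(Set.Ioo (0 : ℝ) 1 • (Subtype.val '' A)) := by
    rw [← Set.image_neg_eq_neg, ← Set.image_neg_eq_neg]
    exact (Set.image_image2_distrib_right fun a b => (smul_neg a b).symm).symm
  rw [h, h', Measure.measure_neg]

instance (d : ℕ) : IsFiniteMeasure (sphMeas d) := by
  unfold sphMeas; infer_instance

theorem measurePreserving_flip {d : ℕ} (R : Set (E d)) :
    MeasurePreserving (flip : E d × Sph d → E d × Sph d) (phaseMeas R) (phaseMeas R) :=
  (MeasurePreserving.id _).prod (measurePreserving_neg_sphMeas d)

theorem measurableEmbedding_flip {d : ℕ} :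
    MeasurableEmbedding (flip : E d × Sph d → E d × Sph d) :=
  ((Homeomorph.refl (E d)).prodCongr (Homeomorph.neg (Sph d))).measurableEmbedding

/-- Even and odd functions are orthogonal with respect to every weight depending on `r` only. -/
theorem integral_even_mul_odd {d : ℕ} {R : Set (E d)} (σ : E d → ℝ) {f g : V0 R}
    (hf : f ∈ parity (phaseMeas R) 1) (hg : g ∈ parity (phaseMeas R) (-1)) :
    ∫ z, σ z.1 * f z * g z ∂(phaseMeas R) = 0 := by
  obtain ⟨f', hf', hff⟩ := hf
  obtain ⟨g', hg', hgg⟩ := hg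
  have h1 : ∫ z, σ z.1 * f z * g z ∂(phaseMeas R) = ∫ z, σ z.1 * f' z * g' z ∂(phaseMeas R) :=
    integral_congr_ae (by filter_upwards [hff, hgg] with z a b; rw [a, b])
  have h2 := (measurePreserving_flip R).integral_comp measurableEmbedding_flip
    fun z => σ z.1 * f' z * g' z
  have h3 : ∀ z, σ (flip z).1 * f' (flip z) * g' (flip z) = -(σ z.1 * f' z * g' z) := fun z => by
    rw [hf', hg']; simp [flip]
  simp only [h3, integral_neg] at h2
  rw [h1]
  linarith

/-! ### Multiplication operators -/

theorem integral_mul_eq_inner {α : Type*} [MeasurableSpace α] {μ : Measure α} (f g : Lp ℝ 2 μ) :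
    ∫ z, f z * g z ∂μ = inner ℝ f g := by
  rw [L2.inner_def]
  exact integral_congr_ae (.of_forall fun z => by simp [mul_comm])

/-- Multiplication by an essentially bounded function, as an operator on `L²`. -/
noncomputable def mulOp {α : Type*} [MeasurableSpace α] {μ : Measure α} {σ : α → ℝ}
    (hσ : MemLp σ ⊤ μ) :
    Lp ℝ 2 μ →L[ℝ] Lp ℝ 2 μ :=
  (ContinuousLinearMap.mul ℝ ℝ).holderL μ ⊤ 2 2 hσ.toLp

section MulOp

variable {α : Type*} [MeasurableSpace α] {μ : Measure α} {σ : α → ℝ}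

theorem coeFn_mulOp (hσ : MemLp σ ⊤ μ) (f : Lp ℝ 2 μ) :
    mulOp hσ f =ᵐ[μ] fun z => σ z * f z := by
  have h := (ContinuousLinearMap.mul ℝ ℝ).coeFn_holder (r := 2) (hσ.toLp σ) f
  filter_upwards [h, hσ.coeFn_toLp] with z h1 h2
  rw [← h2]
  exact h1

theorem norm_mulOp_le (hσ : MemLp σ ⊤ μ) (f : Lp ℝ 2 μ) :
    ‖mulOp hσ f‖ ≤ (eLpNorm σ ⊤ μ).toReal * ‖f‖ := by
  have h := (ContinuousLinearMap.mul ℝ ℝ).norm_holder_apply_apply_le (r := 2) (hσ.toLp σ) f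
  rw [Lp.norm_toLp] at h
  refine h.trans ?_
  gcongr
  exact mul_le_of_le_one_left ENNReal.toReal_nonneg (ContinuousLinearMap.opNorm_mul_le ℝ ℝ)

theorem inner_mulOp (hσ : MemLp σ ⊤ μ) (f g : Lp ℝ 2 μ) :
    inner ℝ (mulOp hσ f) g = ∫ z, σ z * f z * g z ∂μ := by
  rw [← integral_mul_eq_inner]
  exact integral_congr_ae (by filter_upwards [coeFn_mulOp hσ f] with z h; rw [h])

theorem mulOp_coercive (hσ : MemLp σ ⊤ μ) {c : ℝ} (hc : ∀ᵐ z ∂μ, c ≤ σ z) (f : Lp ℝ 2 μ) :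
    c * ‖f‖ ^ 2 ≤ inner ℝ (mulOp hσ f) f := by
  rw [← real_inner_self_eq_norm_sq, ← integral_mul_eq_inner, ← integral_mul_eq_inner,
    ← integral_const_mul]
  refine integral_mono_ae ((L2.integrable_inner (𝕜 := ℝ) f f).const_mul c)
    (L2.integrable_inner (𝕜 := ℝ) (mulOp hσ f) f |>.congr (.of_forall fun z => ?_)) ?_
  · simp [mul_comm]
  · filter_upwards [coeFn_mulOp hσ f, hc] with z h h'
    rw [h]
    nlinarith [mul_self_nonneg (f z)]

end MulOp

/-- A bounded function of `r` is a bounded function on `D`, with no larger norm. -/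
theorem memLp_top_comp_fst {d : ℕ} {R : Set (E d)} {σ : E d → ℝ}
    (hσ : MemLp σ ⊤ (volume.restrict R)) :
    MemLp (fun z : E d × Sph d => σ z.1) ⊤ (phaseMeas R) ∧
    eLpNorm (fun z : E d × Sph d => σ z.1) ⊤ (phaseMeas R) ≤ eLpNorm σ ⊤ (volume.restrict R) := by
  have hle : eLpNorm (fun z : E d × Sph d => σ z.1) ⊤ (phaseMeas R)
      ≤ eLpNorm σ ⊤ (volume.restrict R) := by
    rw [eLpNorm_exponent_top, eLpNorm_exponent_top]
    exact essSup_le_of_ae_le _ (Measure.quasiMeasurePreserving_fst.ae ae_le_eLpNormEssSup)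
  exact ⟨⟨hσ.1.comp_quasiMeasurePreserving Measure.quasiMeasurePreserving_fst,
    hle.trans_lt hσ.2⟩, hle⟩

/-! ### The scattering operator -/

/-- The Schur test for a symmetric kernel with row integrals at most one, acting on the second
variable. -/
theorem lintegral_kernel_sq_le {X S : Type*} [MeasurableSpace X] [MeasurableSpace S]
    (μ : Measure X) (ν : Measure S) [SFinite μ] [SFinite ν] (k : S → S → ENNReal)
    (hk : Measurable (Function.uncurry k)) (hsymm : ∀ s s', k s s' = k s' s)
    (hk1 : ∀ᵐ s ∂ν, ∫⁻ s', k s s' ∂ν ≤ 1) (f : X × S → ENNReal) (hf : Measurable f) :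
    ∫⁻ z, (∫⁻ s', k z.2 s' * f (z.1, s') ∂ν) ^ 2 ∂(μ.prod ν) ≤ ∫⁻ z, f z ^ 2 ∂(μ.prod ν) := by
  -- Cauchy–Schwarz for the measure `k s s' ds'`
  have hcs : ∀ᵐ z ∂(μ.prod ν), (∫⁻ s', k z.2 s' * f (z.1, s') ∂ν) ^ 2
      ≤ ∫⁻ s', k z.2 s' * f (z.1, s') ^ 2 ∂ν := by
    filter_upwards [Measure.quasiMeasurePreserving_snd.ae hk1] with z hz
    have hkz : Measurable fun s' => k z.2 s' := hk.comp measurable_prodMk_left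
    have hfz : Measurable fun s' => f (z.1, s') := hf.comp measurable_prodMk_left
    have h := ENNReal.lintegral_mul_le_Lp_mul_Lq ν Real.HolderConjugate.two_two
      (f := fun s' => k z.2 s' ^ (1 / 2 : ℝ)) (g := fun s' => k z.2 s' ^ (1 / 2 : ℝ) * f (z.1, s'))
      (hkz.pow_const _).aemeasurable ((hkz.pow_const _).mul hfz).aemeasurable
    have e0 : ∀ x : ENNReal, x ^ (1 / 2 : ℝ) * x ^ (1 / 2 : ℝ) = x := fun x => by
      rw [← ENNReal.rpow_add_of_nonneg _ _ (by norm_num) (by norm_num)]; norm_num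
    have e1 : ∀ x : ENNReal, (x ^ (1 / 2 : ℝ)) ^ (2 : ℝ) = x := fun x => by
      rw [← ENNReal.rpow_mul]; norm_num
    simp only [Pi.mul_apply, ← mul_assoc, e0, e1,
      ENNReal.mul_rpow_of_nonneg _ _ (zero_le_two : (0 : ℝ) ≤ 2)] at h
    calc (∫⁻ s', k z.2 s' * f (z.1, s') ∂ν) ^ 2
        ≤ ((∫⁻ s', k z.2 s' ∂ν) ^ (1 / 2 : ℝ)
          * (∫⁻ s', k z.2 s' * f (z.1, s') ^ (2 : ℝ) ∂ν) ^ (1 / 2 : ℝ)) ^ 2 := by gcongr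
      _ = (∫⁻ s', k z.2 s' ∂ν) * ∫⁻ s', k z.2 s' * f (z.1, s') ^ 2 ∂ν := by
          simp only [mul_pow, ENNReal.rpow_two, pow_two (_ ^ (1 / 2 : ℝ)), e0]
      _ ≤ 1 * ∫⁻ s', k z.2 s' * f (z.1, s') ^ 2 ∂ν := by gcongr
      _ = _ := one_mul _
  have hmeas : Measurable fun p : (X × S) × S => k p.1.2 p.2 * f (p.1.1, p.2) ^ 2 :=
    (hk.comp (measurable_fst.snd.prodMk measurable_snd)).mul
      ((hf.comp (measurable_fst.fst.prodMk measurable_snd)).pow_const 2)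
  refine (lintegral_mono_ae hcs).trans ?_
  rw [lintegral_prod _ hmeas.lintegral_prod_right'.aemeasurable,
    lintegral_prod _ (hf.pow_const 2).aemeasurable]
  refine lintegral_mono fun x => ?_
  have hfx : Measurable fun s' => f (x, s') := hf.comp measurable_prodMk_left
  rw [lintegral_lintegral_swap (hk.mul ((hfx.comp measurable_snd).pow_const 2)).aemeasurable]
  refine lintegral_mono_ae ?_
  filter_upwards [hk1] with s' hs'
  simp only [hsymm _ s']
  rw [lintegral_mul_const (f (x, s') ^ 2) (f := k s') (hk.comp measurable_prodMk_left)]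
  exact mul_le_of_le_one_left (zero_le) hs'

section Scattering

variable {d : ℕ} {R : Set (E d)} {θ : ℝ → ℝ}

theorem Theta_congr {v w : E d × Sph d → ℝ} (h : v =ᵐ[phaseMeas R] w) :
    Theta θ v =ᵐ[phaseMeas R] Theta θ w := by
  have h' := Measure.ae_ae_of_ae_prod h
  filter_upwards [Measure.quasiMeasurePreserving_fst.ae h'] with z hz
  refine integral_congr_ae ?_
  filter_upwards [hz] with s' hs'
  rw [hs']

theorem measurable_kernel (hθ : Measurable θ) : Measurable (Function.uncurry fun s s' : Sph d =>
    ‖θ (inner ℝ (s : E d) (s' : E d))‖ₑ) := by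
  have : Continuous fun p : Sph d × Sph d => inner ℝ (p.1 : E d) (p.2 : E d) := by fun_prop
  exact (hθ.comp this.measurable).enorm

/-- The normalisation of `θ` says that the kernel `θ(s · s')` has row integrals one. The Bochner
integral is nonzero, so that the kernel is integrable. -/
theorem lintegral_kernel_eq_one (hθ_nonneg : ∀ x ∈ Set.Icc (-1 : ℝ) 1, 0 ≤ θ x)
    (hθ_norm : ∀ᵐ (s : Sph d) ∂(sphMeas d),
      ∫ s' : Sph d, θ (inner ℝ (s : E d) (s' : E d)) ∂(sphMeas d) = 1) :
    ∀ᵐ (s : Sph d) ∂(sphMeas d),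
      ∫⁻ s' : Sph d, ‖θ (inner ℝ (s : E d) (s' : E d))‖ₑ ∂(sphMeas d) = 1 := by
  filter_upwards [hθ_norm] with s hs
  have hn : ∀ s' : Sph d, 0 ≤ θ (inner ℝ (s : E d) (s' : E d)) := fun s' => by
    refine hθ_nonneg _ (abs_le.mp ?_)
    simpa using abs_real_inner_le_norm (s : E d) (s' : E d)
  have hint : Integrable (fun s' : Sph d => θ (inner ℝ (s : E d) (s' : E d))) (sphMeas d) := by
    by_contra h
    rw [integral_undef h] at hs
    exact zero_ne_one hs
  have := ofReal_integral_eq_lintegral_ofReal hint (.of_forall hn)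
  rw [hs, ENNReal.ofReal_one] at this
  rw [this]
  exact lintegral_congr fun s' => Real.enorm_of_nonneg (hn s')

/-- `θ` is a scattering phase function: measurable, with `θ(s · s')` of `L¹` norm one in `s'` for
almost every `s`. The norm is a lower Lebesgue integral, which includes the integrability. -/
structure IsPhaseFunction (d : ℕ) (θ : ℝ → ℝ) : Prop where
  measurable : Measurable θ
  lintegral_eq_one : ∀ᵐ (s : Sph d) ∂(sphMeas d),
    ∫⁻ s' : Sph d, ‖θ (inner ℝ (s : E d) (s' : E d))‖ₑ ∂(sphMeas d) = 1

variable (hθ : IsPhaseFunction d θ)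
include hθ

/-- The Schur bound for the integrals of absolute values that dominate `Θ f`. It gives both the
integrability of the integrand of `Θ f`, which linearity needs, and the norm bound. -/
theorem lintegral_Theta_sq_le (f : V0 R) :
    ∫⁻ z, (∫⁻ s' : Sph d, ‖θ (inner ℝ (z.2 : E d) (s' : E d))‖ₑ * ‖f (z.1, s')‖ₑ ∂(sphMeas d)) ^ 2
      ∂(phaseMeas R) ≤ ‖f‖ₑ ^ 2 := by
  refine (lintegral_kernel_sq_le (volume.restrict R) (sphMeas d) _ (measurable_kernel hθ.measurable)
    (fun s s' => by rw [real_inner_comm]) (hθ.lintegral_eq_one.mono fun s hs => hs.le)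
    (fun z => ‖f z‖ₑ) (Lp.stronglyMeasurable f).measurable.enorm).trans ?_
  have := eLpNorm_nnreal_pow_eq_lintegral (f := f) (μ := phaseMeas R) (p := 2) two_ne_zero
  rw [Lp.enorm_def]
  simp only [NNReal.coe_ofNat, ENNReal.coe_ofNat, ENNReal.rpow_two] at this
  exact this.ge

theorem integrable_Theta (f : V0 R) : ∀ᵐ z ∂(phaseMeas R), Integrable
    (fun s' : Sph d => θ (inner ℝ (z.2 : E d) (s' : E d)) * f (z.1, s')) (sphMeas d) := by
  have hm : Measurable fun p : (E d × Sph d) × Sph d =>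
      ‖θ (inner ℝ (p.1.2 : E d) (p.2 : E d))‖ₑ * ‖f (p.1.1, p.2)‖ₑ :=
    ((measurable_kernel hθ.measurable).comp (measurable_fst.snd.prodMk measurable_snd)).mul
      ((Lp.stronglyMeasurable f).measurable.comp
        (measurable_fst.fst.prodMk measurable_snd)).enorm
  have hfin := ae_lt_top ((hm.lintegral_prod_right' (ν := sphMeas d)).pow_const 2)
    ((lintegral_Theta_sq_le hθ f).trans_lt (by finiteness)).ne
  filter_upwards [hfin] with z hz
  refine ⟨?_, ?_⟩
  · have hc : Continuous fun s' : Sph d => inner ℝ (z.2 : E d) (s' : E d) := by fun_prop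
    exact ((hθ.measurable.comp hc.measurable).mul
      ((Lp.stronglyMeasurable f).measurable.comp measurable_prodMk_left)).aestronglyMeasurable
  · rw [hasFiniteIntegral_iff_enorm]
    simp only [enorm_mul]
    exact (ENNReal.pow_lt_top_iff.mp hz).resolve_right two_ne_zero

theorem memLp_Theta (f : V0 R) : MemLp (Theta θ f) 2 (phaseMeas R) ∧
    eLpNorm (Theta θ f) 2 (phaseMeas R) ≤ ‖f‖ₑ := by
  have hm : StronglyMeasurable fun p : (E d × Sph d) × Sph d =>
      θ (inner ℝ (p.1.2 : E d) (p.2 : E d)) * f (p.1.1, p.2) := by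
    have hc : Continuous fun p : (E d × Sph d) × Sph d => inner ℝ (p.1.2 : E d) (p.2 : E d) := by
      fun_prop
    exact ((hθ.measurable.comp hc.measurable).mul ((Lp.stronglyMeasurable f).measurable.comp
        (measurable_fst.fst.prodMk measurable_snd))).stronglyMeasurable
  have hle : eLpNorm (Theta θ f) 2 (phaseMeas R) ≤ ‖f‖ₑ := by
    have h := eLpNorm_nnreal_pow_eq_lintegral (f := Theta θ f) (μ := phaseMeas R) (p := 2)
      two_ne_zero
    simp only [NNReal.coe_ofNat, ENNReal.coe_ofNat, ENNReal.rpow_two] at h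
    rw [← ENNReal.pow_le_pow_left_iff two_ne_zero, h]
    refine le_trans (lintegral_mono fun z => ?_) (lintegral_Theta_sq_le hθ f)
    gcongr
    refine (enorm_integral_le_lintegral_enorm _).trans_eq ?_
    simp only [enorm_mul]
  exact ⟨⟨(hm.integral_prod_right' (ν := sphMeas d)).aestronglyMeasurable,
    hle.trans_lt (by finiteness)⟩, hle⟩

/-- The scattering operator `Θ` on `L²(D)`; its values are represented by `Theta θ f`. -/
noncomputable def thetaOp (R : Set (E d)) : V0 R →L[ℝ] V0 R :=
  LinearMap.mkContinuous
    { toFun := fun f => (memLp_Theta hθ f).1.toLp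
      map_add' := fun f g => by
        rw [← MemLp.toLp_add]
        refine MemLp.toLp_congr _ _ ?_
        filter_upwards [Theta_congr (θ := θ) (Lp.coeFn_add f g), integrable_Theta hθ f,
          integrable_Theta hθ g] with z h hf hg
        rw [h, Pi.add_apply, Theta, Theta, Theta, ← integral_add hf hg]
        simp only [Pi.add_apply, mul_add]
      map_smul' := fun c f => by
        rw [RingHom.id_apply, ← MemLp.toLp_const_smul]
        refine MemLp.toLp_congr _ _ ?_
        filter_upwards [Theta_congr (θ := θ) (Lp.coeFn_smul c f)] with z h
        rw [h, Pi.smul_apply, Theta, Theta, smul_eq_mul, ← integral_const_mul]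
        simp only [Pi.smul_apply, smul_eq_mul, mul_left_comm] }
    1 fun f => by
      rw [one_mul]
      change ‖(memLp_Theta hθ f).1.toLp‖ ≤ _
      rw [Lp.norm_toLp]
      exact ENNReal.toReal_mono (Lp.eLpNorm_ne_top f)
        ((memLp_Theta hθ f).2.trans_eq (Lp.enorm_def f))

theorem coeFn_thetaOp (f : V0 R) : thetaOp hθ R f =ᵐ[phaseMeas R] Theta θ f :=
  (memLp_Theta hθ f).1.coeFn_toLp

theorem norm_thetaOp_le (f : V0 R) : ‖thetaOp hθ R f‖ ≤ ‖f‖ := by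
  refine ((thetaOp hθ R).le_of_opNorm_le (LinearMap.mkContinuous_norm_le _ zero_le_one _) f).trans ?_
  rw [one_mul]

/-- The scattering operator commutes with multiplication by functions of `r`. -/
theorem thetaOp_mulOp {σ : E d → ℝ} (hσ : MemLp (fun z : E d × Sph d => σ z.1) ⊤ (phaseMeas R))
    (f : V0 R) : thetaOp hθ R (mulOp hσ f) = mulOp hσ (thetaOp hθ R f) := by
  refine Lp.ext ?_
  filter_upwards [coeFn_thetaOp hθ (mulOp hσ f), coeFn_mulOp hσ (thetaOp hθ R f),
    coeFn_thetaOp hθ f, Theta_congr (θ := θ) (coeFn_mulOp hσ f)] with z h1 h2 h3 h4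
  rw [h1, h2, h3, h4, Theta, Theta, ← integral_const_mul]
  simp only [mul_left_comm]

end Scattering

/-! ### The variational formulation in terms of `L²` inner products -/

theorem isClosed_V1even {d : ℕ} (R : Set (E d)) :
    IsClosed (V1even R : Set (V0 R × V0 R × LB R)) :=
  (Submodule.isClosed_topologicalClosure _).inter
    ((isClosed_parity _ one_ne_zero).prod
      ((isClosed_parity _ (neg_ne_zero.mpr one_ne_zero)).prod (isClosed_parity _ one_ne_zero)))

section Forms

variable {d : ℕ} {R : Set (E d)} {σs σt : E d → ℝ} {θ : ℝ → ℝ} {q qb : E d × Sph d → ℝ}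

theorem W.fn_sub (u v : W R) : W.fn (u - v) = W.fn u - W.fn v :=
  add_sub_add_comm (W.even u) (W.odd u) (W.even v) (W.odd v) |>.symm

theorem tForm_eq_inner (hσ : MemLp (fun z : E d × Sph d => σt z.1) ⊤ (phaseMeas R)) (u v : W R) :
    tForm σt u v = inner ℝ (W.gradEven u) (W.odd v) - inner ℝ (W.odd u) (W.gradEven v)
      + inner ℝ (mulOp hσ (W.fn u)) (W.fn v) + inner ℝ (W.traceEven u) (W.traceEven v) := by
  rw [tForm, integral_mul_eq_inner, integral_mul_eq_inner, integral_mul_eq_inner, inner_mulOp]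

theorem sForm_eq_inner (hθ : IsPhaseFunction d θ)
    (hσ : MemLp (fun z : E d × Sph d => σs z.1) ⊤ (phaseMeas R)) (u v : W R) :
    sForm σs θ u v = inner ℝ (mulOp hσ (thetaOp hθ R (W.fn u))) (W.fn v) := by
  rw [sForm, inner_mulOp]
  refine integral_congr_ae ?_
  filter_upwards [coeFn_thetaOp hθ (W.fn u)] with z h
  rw [h]

theorem exists_load_eq_inner (hq : MemLp q 2 (phaseMeas R)) (hqb : MemLp qb 2 (inflowMeas R)) :
    ∃ (h : V0 R) (k : LB R), ∀ v : W R,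
      load q qb v = inner ℝ h (W.fn v) + inner ℝ k (W.traceEven v) := by
  -- restriction of traces to the inflow boundary
  let T : LB R →L[ℝ] Lp ℝ 2 (inflowMeas R) :=
    LpToLpRestrictCLM (E d × Sph d) ℝ ℝ (bdryMeas R) 2 (inflow R)
  refine ⟨hq.toLp, (2 : ℝ) • ContinuousLinearMap.adjoint T hqb.toLp, fun v => ?_⟩
  rw [load, real_inner_smul_left, ContinuousLinearMap.adjoint_inner_left,
    ← integral_mul_eq_inner, ← integral_mul_eq_inner]
  congr 1
  · refine integral_congr_ae ?_
    filter_upwards [hq.coeFn_toLp] with z h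
    rw [h]
  · congr 1
    refine integral_congr_ae ?_
    have hT : T (W.traceEven v) =ᵐ[inflowMeas R] W.traceEven v := LpToLpRestrictCLM_coeFn ℝ _ _
    filter_upwards [hqb.coeFn_toLp, hT] with z h h'
    rw [h, h']

theorem tForm_sub_left (hσ : MemLp (fun z : E d × Sph d => σt z.1) ⊤ (phaseMeas R))
    (u u' v : W R) : tForm σt (u - u') v = tForm σt u v - tForm σt u' v := by
  have h1 : W.gradEven (u - u') = W.gradEven u - W.gradEven u' := rfl
  have h2 : W.odd (u - u') = W.odd u - W.odd u' := rfl
  have h3 : W.traceEven (u - u') = W.traceEven u - W.traceEven u' := rfl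
  simp only [tForm_eq_inner hσ, h1, h2, h3, W.fn_sub, map_sub, inner_sub_left]
  ring

theorem sForm_sub_left (hθ : IsPhaseFunction d θ)
    (hσ : MemLp (fun z : E d × Sph d => σs z.1) ⊤ (phaseMeas R)) (u u' v : W R) :
    sForm σs θ (u - u') v = sForm σs θ u v - sForm σs θ u' v := by
  simp only [sForm_eq_inner hθ hσ, W.fn_sub, map_sub, inner_sub_left]

/-- Well-posedness of the transport problem without scattering whose load is a residual. -/
theorem existsUnique_isPrecResidual (hθ : IsPhaseFunction d θ)
    (hs : MemLp (fun z : E d × Sph d => σs z.1) ⊤ (phaseMeas R))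
    (ht : MemLp (fun z : E d × Sph d => σt z.1) ⊤ (phaseMeas R))
    {c : ℝ} (hc : 0 < c) (hct : ∀ᵐ z ∂(phaseMeas R), c ≤ σt z.1)
    (hq : MemLp q 2 (phaseMeas R)) (hqb : MemLp qb 2 (inflowMeas R)) (w : W R) :
    ∃! r : W R, IsPrecResidual σs σt θ q qb w r := by
  obtain ⟨h, k, hload⟩ := exists_load_eq_inner hq hqb
  let a : V0 R := h - mulOp ht (W.fn w) + mulOp hs (thetaOp hθ R (W.fn w))
  have hres : ∀ v : W R, residual σs σt θ q qb w v = inner ℝ a v.1.1.1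
      + inner ℝ (W.odd w) v.1.1.2.1 + inner ℝ (k - W.traceEven w) v.1.1.2.2
      + inner ℝ (a - W.gradEven w) (v.2 : V0 R) := fun v => by
    change _ = inner ℝ a (W.even v) + inner ℝ (W.odd w) (W.gradEven v)
      + inner ℝ (k - W.traceEven w) (W.traceEven v) + inner ℝ (a - W.gradEven w) (W.odd v)
    rw [residual, hload, tForm_eq_inner ht, sForm_eq_inner hθ hs]
    simp only [a, W.fn, inner_sub_left, inner_add_left, inner_add_right]
    ring
  obtain ⟨Φ, hΦs, hΦ⟩ := exists_hilbert_param (H := V0 R) (K := LB R)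
  have key := existsUnique_mixed_of_param Φ hΦs hΦ (V0odd R)
    (isClosed_parity _ (neg_ne_zero.mpr one_ne_zero)) (V1even R) (isClosed_V1even R)
    (fun y hy => hy.2.2.1) (mulOp ht) hc (mulOp_coercive ht hct)
    (fun y hy o ho => by rw [inner_mulOp]; exact integral_even_mul_odd σt hy.2.1 ho)
    (fun y hy o ho => by
      rw [inner_mulOp, ← integral_even_mul_odd σt hy.2.1 ho]
      exact integral_congr_ae (.of_forall fun z => mul_right_comm _ _ _))
    a (W.odd w) (a - W.gradEven w) (k - W.traceEven w)
  refine (existsUnique_congr fun r => forall_congr' fun v => ?_).mp key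
  rw [tForm_eq_inner ht, hres]
  rfl

/-! ### Contraction of the source iteration -/

theorem memLp_sqrt_top {α : Type*} [MeasurableSpace α] {μ : Measure α} {σ : α → ℝ}
    (hσ : MemLp σ ⊤ μ) : MemLp (fun x => √(σ x)) ⊤ μ := by
  refine ((memLp_top_const (1 : ℝ)).add hσ.norm).of_le
    (Real.continuous_sqrt.comp_aestronglyMeasurable hσ.1) (.of_forall fun x => ?_)
  rw [Pi.add_apply, Real.norm_of_nonneg (Real.sqrt_nonneg _), Real.norm_eq_abs, Real.norm_eq_abs,
    abs_of_nonneg (by positivity)]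
  refine (Real.sqrt_le_sqrt (le_abs_self _)).trans (Real.sqrt_le_iff.mpr ⟨by positivity, ?_⟩)
  nlinarith [abs_nonneg (σ x)]

theorem weightedNorm_nonneg (σt : E d → ℝ) (u : W R) : 0 ≤ weightedNorm σt u :=
  ENNReal.toReal_nonneg

theorem weightedNorm_eq_norm
    (hm : MemLp (fun z : E d × Sph d => √(σt z.1)) ⊤ (phaseMeas R)) (u : W R) :
    weightedNorm σt u = ‖mulOp hm (W.fn u)‖ := by
  rw [weightedNorm, Lp.norm_def, eLpNorm_congr_ae (coeFn_mulOp hm (W.fn u))]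

/-- The skew-symmetric part of `t` vanishes on the diagonal and the boundary term is
nonnegative. -/
theorem sq_weightedNorm_le_tForm (ht : MemLp (fun z : E d × Sph d => σt z.1) ⊤ (phaseMeas R))
    (hm : MemLp (fun z : E d × Sph d => √(σt z.1)) ⊤ (phaseMeas R))
    (hpos : ∀ᵐ z ∂(phaseMeas R), 0 < σt z.1) (u : W R) :
    weightedNorm σt u ^ 2 ≤ tForm σt u u := by
  have h : inner ℝ (mulOp ht (W.fn u)) (W.fn u) = ‖mulOp hm (W.fn u)‖ ^ 2 := by
    rw [← real_inner_self_eq_norm_sq, inner_mulOp, inner_mulOp]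
    refine integral_congr_ae ?_
    filter_upwards [coeFn_mulOp hm (W.fn u), hpos] with z h1 h2
    rw [h1]
    linear_combination (-(W.fn u z * W.fn u z)) * Real.mul_self_sqrt h2.le
  rw [tForm_eq_inner ht, weightedNorm_eq_norm hm, h, real_inner_comm (W.odd u),
    real_inner_self_eq_norm_sq]
  nlinarith [sq_nonneg ‖W.traceEven u‖]

/-- The scattering form is bounded by `ρ` in the norm weighted with `σ_t`: since the weight depends
on `r` only, it commutes with `Θ`, which is a contraction of `L²(D)`. -/
theorem sForm_le_rho_mul (hθ : IsPhaseFunction d θ)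
    (hs : MemLp (fun z : E d × Sph d => σs z.1) ⊤ (phaseMeas R))
    (hm : MemLp (fun z : E d × Sph d => √(σt z.1)) ⊤ (phaseMeas R))
    (hk : MemLp (fun r => σs r / σt r) ⊤ (volume.restrict R))
    (hpos : ∀ᵐ z ∂(phaseMeas R), 0 < σt z.1) (u v : W R) :
    sForm σs θ u v ≤ rho R σs σt * weightedNorm σt u * weightedNorm σt v := by
  obtain ⟨hk', hkle⟩ := memLp_top_comp_fst hk
  have h : sForm σs θ u v
      = inner ℝ (mulOp hk' (thetaOp hθ R (mulOp hm (W.fn u)))) (mulOp hm (W.fn v)) := by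
    rw [thetaOp_mulOp hθ (σ := fun r => √(σt r)), sForm_eq_inner hθ hs, inner_mulOp, inner_mulOp]
    refine integral_congr_ae ?_
    filter_upwards [coeFn_mulOp hm (W.fn v), coeFn_mulOp hm (thetaOp hθ R (W.fn u)), hpos]
      with z h1 h2 h3
    rw [h1, h2]
    have e1 := Real.mul_self_sqrt h3.le
    have e2 := div_mul_cancel₀ (σs z.1) h3.ne'
    linear_combination (-(thetaOp hθ R (W.fn u) z * W.fn v z)) * e2
      - (σs z.1 / σt z.1 * thetaOp hθ R (W.fn u) z * W.fn v z) * e1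
  rw [h, weightedNorm_eq_norm hm, weightedNorm_eq_norm hm]
  refine (real_inner_le_norm _ _).trans ?_
  gcongr
  refine (norm_mulOp_le hk' _).trans ?_
  gcongr
  · exact ENNReal.toReal_nonneg
  · exact ENNReal.toReal_mono hk.2.ne hkle
  · exact norm_thetaOp_le hθ _

end Forms

end RTE

theorem mainTheorem3 {d : ℕ} (hd : 1 ≤ d) (R : Set (RTE.E d)) (hRopen : IsOpen R)
    (hRlip : RTE.HasLipschitzBoundary R)
    (σs σt : RTE.E d → ℝ)
    (hσs : MemLp σs ⊤ (volume.restrict R)) (hσt : MemLp σt ⊤ (volume.restrict R))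
    (hσs_pos : ∀ᵐ r ∂(volume.restrict R), 0 < σs r)
    (hσt_pos : ∀ᵐ r ∂(volume.restrict R), 0 < σt r)
    (habs : ∃ c₀ > 0, ∀ᵐ r ∂(volume.restrict R), c₀ ≤ σt r - σs r)
    (θ : ℝ → ℝ) (hθ_meas : Measurable θ) (hθ_nonneg : ∀ x ∈ Set.Icc (-1 : ℝ) 1, 0 ≤ θ x)
    (hθ_norm : ∀ᵐ (s : RTE.Sph d) ∂(RTE.sphMeas d),
      ∫ s' : RTE.Sph d, θ (inner ℝ (s : RTE.E d) (s' : RTE.E d)) ∂(RTE.sphMeas d) = 1)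
    (q qb : RTE.E d × RTE.Sph d → ℝ)
    (hq : MemLp q 2 (RTE.phaseMeas R)) (hqb : MemLp qb 2 (RTE.inflowMeas R)) :
    (∀ w : RTE.W R, ∃! r : RTE.W R, RTE.IsPrecResidual σs σt θ q qb w r) ∧
    ∀ u uhalf : RTE.W R,
      (∀ v : RTE.W R, RTE.tForm σt uhalf v = RTE.sForm σs θ u v + RTE.load q qb v) →
      RTE.weightedNorm σt (RTE.precResidual σs σt θ q qb uhalf)
          ≤ RTE.rho R σs σt * RTE.weightedNorm σt (RTE.precResidual σs σt θ q qb u) ∧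
      RTE.precResidual σs σt θ q qb u = uhalf - u ∧
      ∀ v : RTE.W R, RTE.tForm σt (RTE.precResidual σs σt θ q qb uhalf) v
          = RTE.sForm σs θ (RTE.precResidual σs σt θ q qb u) v := by
  obtain ⟨c₀, hc₀, hc⟩ := habs
  have hθ : RTE.IsPhaseFunction d θ :=
    ⟨hθ_meas, RTE.lintegral_kernel_eq_one hθ_nonneg hθ_norm⟩
  have hs := (RTE.memLp_top_comp_fst hσs).1
  have ht := (RTE.memLp_top_comp_fst hσt).1
  have hm := RTE.memLp_sqrt_top ht
  have hk : MemLp (fun r => σs r / σt r) ⊤ (volume.restrict R) := by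
    refine memLp_top_of_bound (hσs.1.aemeasurable.div hσt.1.aemeasurable).aestronglyMeasurable 1 ?_
    filter_upwards [hσs_pos, hσt_pos, hc] with r h1 h2 h3
    rw [Real.norm_of_nonneg (by positivity), div_le_one h2]
    linarith
  have hpos : ∀ᵐ z ∂(RTE.phaseMeas R), 0 < σt z.1 :=
    Measure.quasiMeasurePreserving_fst.ae hσt_pos
  have hct : ∀ᵐ z ∂(RTE.phaseMeas R), c₀ ≤ σt z.1 := by
    have h : ∀ᵐ r ∂(volume.restrict R), c₀ ≤ σt r := by
      filter_upwards [hσs_pos, hc] with r h1 h2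
      linarith
    exact Measure.quasiMeasurePreserving_fst.ae h
  have hex := RTE.existsUnique_isPrecResidual hθ hs ht hc₀ hct hq hqb
  have hspec : ∀ w : RTE.W R, RTE.IsPrecResidual σs σt θ q qb w (RTE.precResidual σs σt θ q qb w) := by
    intro w
    rw [RTE.precResidual, dif_pos (hex w).exists]
    exact (hex w).exists.choose_spec
  refine ⟨hex, fun u uhalf hu => ?_⟩
  have hdiff : RTE.precResidual σs σt θ q qb u = uhalf - u := by
    refine (hex u).unique (hspec u) fun v => ?_
    rw [RTE.tForm_sub_left ht, hu, RTE.residual]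
    ring
  have hnext : ∀ v : RTE.W R, RTE.tForm σt (RTE.precResidual σs σt θ q qb uhalf) v
      = RTE.sForm σs θ (RTE.precResidual σs σt θ q qb u) v := by
    intro v
    rw [hspec uhalf v, hdiff, RTE.sForm_sub_left hθ hs, RTE.residual, hu]
    ring
  refine ⟨?_, hdiff, hnext⟩
  -- the equation for the next residual, tested with that residual
  have h1 := (RTE.sq_weightedNorm_le_tForm ht hm hpos
    (RTE.precResidual σs σt θ q qb uhalf)).trans_eq (hnext _)
  have h2 := h1.trans (RTE.sForm_le_rho_mul hθ hs hm hk hpos _ _)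
  rcases (RTE.weightedNorm_nonneg σt (RTE.precResidual σs σt θ q qb uhalf)).eq_or_lt with h | h
  · rw [← h]
    exact mul_nonneg ENNReal.toReal_nonneg (RTE.weightedNorm_nonneg _ _)
  · rw [pow_two] at h2
    exact le_of_mul_le_mul_right h2 h
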